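/- **Proposition 4.3.** Let $k$ be a commutative artinian ring with minimal injective cogenerator $E$, and write $D=\mathrm{Hom}_k(-,E)$. Let $\mathcal A$ be a $k$-linear abelian category which is Hom-finite, i.e. every $\mathrm{Hom}_{\mathcal A}(X,Y)$ is a finitely generated $k$-module. Call a morphism $f$ of $\mathcal A$ *projectively trivial* if $\mathrm{Ext}^1_{\mathcal A}(f,-)=0$ and *injectively trivial* if $\mathrm{Ext}^1_{\mathcal A}(-,f)=0$. Let $\underline{\mathcal A}$ and $\overline{\mathcal A}$ be the factor categories of $\mathcal A$ by the ideals of projectively, respectively injectively, trivial morphisms, with Hom spaces $\underline{\mathrm{Hom}}_{\mathcal A}$ and $\overline{\mathrm{Hom}}_{\mathcal A}$. Suppose that $\mathcal A$ has Auslander–Reiten duality: there are a $k$-linear equivalence $\tau\colon\underline{\mathcal A}\to\overline{\mathcal A}$ and $k$-linear isomorphisms $$\Phi_{X,Y}\colon D\,\mathrm{Ext}^1_{\mathcal A}(X,Y)\xrightarrow{\ \sim\ }\overline{\mathrm{Hom}}_{\mathcal A}(Y,\tau X),$$ functorial in $X$ and $Y$. Fix a quasi-inverse $\tau^{-1}$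 of $\tau$ and a natural isomorphism $\varepsilon\colon\tau^{-1}\tau\to\mathrm{Id}_{\underline{\mathcal A}}$, let $K,Y$ be objects of $\mathcal A$, put $C=\tau^{-1}K$, and let $$\Psi_{Y,K}\colon D\,\mathrm{Ext}^1_{\mathcal A}(Y,K)\xrightarrow{\ \sim\ }\underline{\mathrm{Hom}}_{\mathcal A}(C,Y),\qquad \Psi_{Y,K}(\theta)=\varepsilon_Y\circ\tau^{-1}(\Phi_{Y,K}(\theta)).$$ Write $\Gamma(Z)=\mathrm{End}_{\mathcal A}(Z)$, and let $\mathrm{sub}_R M$ denote the poset of finitely generated $R$-submodules of $M$. The ring $\Gamma(K)$ acts on $\mathrm{Ext}^1_{\mathcal A}(Y,K)$ by pushout, and $\Gamma(C)^{\mathrm{op}}$ acts on $\underline{\mathrm{Hom}}_{\mathcal A}(C,Y)$ by precomposition. Let $[\to Y\rangle_{\mathrm{epi}}$ be the set of classes $[\alpha\rangle$ of epimorphisms $\alpha\colon X\to Y$, where two epimorphisms are equivalent if each factors through the other. Define * $\eta_{C,Y}([\alpha\rangle)$ as the image of $\underline{\mathrm{Hom}}_{\mathcal A}(C,\alpha)\colon\underline{\mathrm{Hom}}_{\mathcal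 A}(C,X)\to\underline{\mathrm{Hom}}_{\mathcal A}(C,Y)$; * $\delta_{K,Y}([\alpha\rangle)$ as the image of the connecting map $\mathrm{Hom}_{\mathcal A}(\mathrm{Ker}\,\alpha,K)\to\mathrm{Ext}^1_{\mathcal A}(Y,K)$, $u\mapsto[u.\xi_\alpha]$, where $u.\xi_\alpha$ is the pushout along $u$ of the exact sequence $\xi_\alpha\colon 0\to\mathrm{Ker}\,\alpha\to X\xrightarrow{\alpha}Y\to0$; * $\gamma_{K,Y}(L)$, for a $\Gamma(K)$-submodule $L\subseteq\mathrm{Ext}^1_{\mathcal A}(Y,K)$, as the kernel of $\psi\colon\underline{\mathrm{Hom}}_{\mathcal A}(C,Y)\to DL$, $\psi(f)=\Psi_{Y,K}^{-1}(f)|_L$. Then all $\Gamma(K)$-submodules of $\mathrm{Ext}^1_{\mathcal A}(Y,K)$ and all $\Gamma(C)^{\mathrm{op}}$-submodules of $\underline{\mathrm{Hom}}_{\mathcal A}(C,Y)$ are finitely generated, the map $$\gamma_{K,Y}\colon\mathrm{sub}_{\Gamma(K)}\,\mathrm{Ext}^1_{\mathcal A}(Y,K)\longrightarrow\mathrm{sub}_{\Gamma(C)^{\mathrm{op}}}\,\underline{\mathrm{Hom}}_{\mathcal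 A}(C,Y)$$ is an anti-isomorphism of posets, and $$\eta_{C,Y}=\gamma_{K,Y}\circ\delta_{K,Y}\quad\text{on } [\to Y\rangle_{\mathrm{epi}}.$$ -/

import Mathlib

open CategoryTheory CategoryTheory.Abelian CategoryTheory.Limits

universe w v u t

namespace ARTriangle

noncomputable section

/-! ### The duality `D = Hom_k(-, E)` -/

/-- `E` is the minimal injective cogenerator of the commutative artinian ring `k`: the injective
envelope of `k / rad k` (over such a ring, `k / rad k` is the direct sum of one copy of each
simple module). -/
structure IsMinimalInjectiveCogenerator (k : Type t) [CommRing k] (E : Type t) [AddCommGroup E]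
    [Module k E] : Prop where
  injective : Module.Injective k E
  exists_essential_embedding : ∃ i : (k ⧸ Ring.jacobson k) →ₗ[k] E, Function.Injective i ∧
    ∀ N : Submodule k E, N ≠ ⊥ → N ⊓ LinearMap.range i ≠ ⊥

section Epi

variable {A : Type u} [Category.{v} A] [Abelian A]

/-! ### Right equivalence classes of epimorphisms -/

/-- An epimorphism `hom : source ⟶ Y`. -/
structure EpiTo (Y : A) where
  source : A
  hom : source ⟶ Y
  epi : Epi hom

/-- `α ≤ α'` if `α` factors through `α'`. -/
instance (Y : A) : Preorder (EpiTo Y) where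
  le α α' := ∃ h : α.source ⟶ α'.source, h ≫ α'.hom = α.hom
  le_refl α := ⟨𝟙 _, Category.id_comp _⟩
  le_trans := by
    rintro α β γ ⟨f, hf⟩ ⟨g, hg⟩
    exact ⟨f ≫ g, by rw [Category.assoc, hg, hf]⟩

/-- The poset `[⟶ Y⟩_epi` of right equivalence classes of epimorphisms to `Y`: two epimorphisms
are right equivalent if each of them factors through the other. -/
abbrev EpiClass (Y : A) := Antisymmetrization (EpiTo Y) (· ≤ ·)

/-- The exact sequence `0 ⟶ Ker α ⟶ X ⟶ Y ⟶ 0` of an epimorphism `α`. -/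
def kernelSequence {Y : A} (α : EpiTo Y) : ShortComplex A :=
  ShortComplex.mk (kernel.ι α.hom) α.hom (kernel.condition α.hom)

lemma kernelSequence_shortExact {Y : A} (α : EpiTo Y) : (kernelSequence α).ShortExact where
  exact := ShortComplex.exact_of_f_is_kernel _ (kernelIsKernel α.hom)
  mono_f := inferInstanceAs (Mono (kernel.ι α.hom))
  epi_g := α.epi

end Epi

section Abelian

variable {A : Type u} [Category.{v} A] [Abelian A] [HasExt.{w} A]

/-! ### Projectively and injectively trivial morphisms -/

/-- `f : X ⟶ Y` is projectively trivial if `Ext¹(f, -) = 0`, i.e. the pullback `ξ.f` of every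
extension `ξ` of `Y` is trivial. -/
def ProjectivelyTrivial {X Y : A} (f : X ⟶ Y) : Prop :=
  ∀ (Z : A) (e : Ext.{w} Y Z 1), (Ext.mk₀ f).comp e (zero_add 1) = 0

/-- `f : X ⟶ Y` is injectively trivial if `Ext¹(-, f) = 0`, i.e. the pushout `f.ξ` of every
extension `ξ` by `X` is trivial. -/
def InjectivelyTrivial {X Y : A} (f : X ⟶ Y) : Prop :=
  ∀ (Z : A) (e : Ext.{w} Z X 1), e.comp (Ext.mk₀ f) (add_zero 1) = 0

variable (A) in
/-- Equality modulo the ideal of projectively trivial morphisms. -/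
def projRel : HomRel A := fun _ _ f g => ProjectivelyTrivial.{w} (f - g)

variable (A) in
/-- Equality modulo the ideal of injectively trivial morphisms. -/
def injRel : HomRel A := fun _ _ f g => InjectivelyTrivial.{w} (f - g)

lemma projRel_iff {X Y : A} (f g : X ⟶ Y) : projRel.{w} A f g ↔
    ∀ (Z : A) (e : Ext.{w} Y Z 1),
      (Ext.mk₀ f).comp e (zero_add 1) = (Ext.mk₀ g).comp e (zero_add 1) := by
  simp only [projRel, ProjectivelyTrivial]
  refine forall₂_congr fun Z e => ?_
  rw [sub_eq_add_neg, Ext.mk₀_add, Ext.mk₀_neg, Ext.add_comp, Ext.neg_comp, add_neg_eq_zero]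

lemma injRel_iff {X Y : A} (f g : X ⟶ Y) : injRel.{w} A f g ↔
    ∀ (Z : A) (e : Ext.{w} Z X 1),
      e.comp (Ext.mk₀ f) (add_zero 1) = e.comp (Ext.mk₀ g) (add_zero 1) := by
  simp only [injRel, InjectivelyTrivial]
  refine forall₂_congr fun Z e => ?_
  rw [sub_eq_add_neg, Ext.mk₀_add, Ext.mk₀_neg, Ext.comp_add, Ext.comp_neg, add_neg_eq_zero]

instance : Congruence (projRel.{w} A) where
  equivalence :=
    { refl := fun f => (projRel_iff _ _).2 fun _ _ => rfl
      symm := fun h => (projRel_iff _ _).2 fun Z e => ((projRel_iff _ _).1 h Z e).symm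
      trans := fun h h' => (projRel_iff _ _).2 fun Z e =>
        ((projRel_iff _ _).1 h Z e).trans ((projRel_iff _ _).1 h' Z e) }
  comp_left := by
    intro X Y Z f g g' h
    refine (projRel_iff _ _).2 fun W e => ?_
    rw [← Ext.mk₀_comp_mk₀_assoc, ← Ext.mk₀_comp_mk₀_assoc, (projRel_iff _ _).1 h W e]
  comp_right := by
    intro X Y Z f f' g h
    refine (projRel_iff _ _).2 fun W e => ?_
    rw [← Ext.mk₀_comp_mk₀_assoc, ← Ext.mk₀_comp_mk₀_assoc, (projRel_iff _ _).1 h W _]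

lemma comp_mk₀_comp {X Y Z W : A} (e : Ext.{w} X Y 1) (f : Y ⟶ Z) (g : Z ⟶ W) :
    e.comp (Ext.mk₀ (f ≫ g)) (add_zero 1) =
      (e.comp (Ext.mk₀ f) (add_zero 1)).comp (Ext.mk₀ g) (add_zero 1) := by
  rw [← Ext.mk₀_comp_mk₀, Ext.comp_assoc _ _ _ (add_zero 1) (add_zero 0) (by simp)]

instance : Congruence (injRel.{w} A) where
  equivalence :=
    { refl := fun f => (injRel_iff _ _).2 fun _ _ => rfl
      symm := fun h => (injRel_iff _ _).2 fun Z e => ((injRel_iff _ _).1 h Z e).symm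
      trans := fun h h' => (injRel_iff _ _).2 fun Z e =>
        ((injRel_iff _ _).1 h Z e).trans ((injRel_iff _ _).1 h' Z e) }
  comp_left := by
    intro X Y Z f g g' h
    refine (injRel_iff _ _).2 fun W e => ?_
    rw [comp_mk₀_comp, comp_mk₀_comp, (injRel_iff _ _).1 h W _]
  comp_right := by
    intro X Y Z f f' g h
    refine (injRel_iff _ _).2 fun W e => ?_
    rw [comp_mk₀_comp, comp_mk₀_comp, (injRel_iff _ _).1 h W e]

lemma projRel_add ⦃X Y : A⦄ (f₁ f₂ g₁ g₂ : X ⟶ Y) (h : projRel.{w} A f₁ f₂)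
    (h' : projRel.{w} A g₁ g₂) : projRel.{w} A (f₁ + g₁) (f₂ + g₂) :=
  (projRel_iff _ _).2 fun Z e => by
    rw [Ext.mk₀_add, Ext.mk₀_add, Ext.add_comp, Ext.add_comp, (projRel_iff _ _).1 h Z e,
      (projRel_iff _ _).1 h' Z e]

lemma injRel_add ⦃X Y : A⦄ (f₁ f₂ g₁ g₂ : X ⟶ Y) (h : injRel.{w} A f₁ f₂)
    (h' : injRel.{w} A g₁ g₂) : injRel.{w} A (f₁ + g₁) (f₂ + g₂) :=
  (injRel_iff _ _).2 fun Z e => by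
    rw [Ext.mk₀_add, Ext.mk₀_add, Ext.comp_add, Ext.comp_add, (injRel_iff _ _).1 h Z e,
      (injRel_iff _ _).1 h' Z e]

/-! ### The factor categories -/

variable (A) in
/-- The factor category of `A` by the ideal of projectively trivial morphisms. -/
abbrev Stable := Quotient (projRel.{w} A)

variable (A) in
/-- The factor category of `A` by the ideal of injectively trivial morphisms. -/
abbrev Costable := Quotient (injRel.{w} A)

variable (A) in
/-- The projection functor from `A` to the stable category. -/
abbrev toStable : A ⥤ Stable.{w} A := Quotient.functor (projRel.{w} A)

variable (A) in
/-- The projection functor from `A` to the costable category. -/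
abbrev toCostable : A ⥤ Costable.{w} A := Quotient.functor (injRel.{w} A)

instance : Preadditive (Stable.{w} A) := Quotient.preadditive _ projRel_add

instance : Preadditive (Costable.{w} A) := Quotient.preadditive _ injRel_add

instance : (toStable.{w} A).Additive := Quotient.functor_additive _ projRel_add

instance : (toCostable.{w} A).Additive := Quotient.functor_additive _ injRel_add

section Linear

variable {k : Type t} [CommRing k] [Linear k A]

lemma projRel_smul (a : k) ⦃X Y : A⦄ (f g : X ⟶ Y) (h : projRel.{w} A f g) :
    projRel.{w} A (a • f) (a • g) :=
  (projRel_iff _ _).2 fun Z e => by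
    rw [Ext.mk₀_smul, Ext.mk₀_smul, Ext.smul_comp, Ext.smul_comp, (projRel_iff _ _).1 h Z e]

lemma injRel_smul (a : k) ⦃X Y : A⦄ (f g : X ⟶ Y) (h : injRel.{w} A f g) :
    injRel.{w} A (a • f) (a • g) :=
  (injRel_iff _ _).2 fun Z e => by
    rw [Ext.mk₀_smul, Ext.mk₀_smul, Ext.comp_smul, Ext.comp_smul, (injRel_iff _ _).1 h Z e]

instance : Linear k (Stable.{w} A) := Quotient.linear k _ projRel_smul

instance : Linear k (Costable.{w} A) := Quotient.linear k _ injRel_smul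

end Linear

/-! ### Module structures over endomorphism rings -/

/-- The left `Γ(K)`-module structure on `Ext¹(Y, K)`: `u • [ξ]` is the class of the pushout of `ξ`
along `u`. -/
instance extModule (Y K : A) : Module (End K) (Ext.{w} Y K 1) where
  smul u e := e.comp (Ext.mk₀ (show K ⟶ K from u)) (add_zero 1)
  one_smul e := Ext.comp_mk₀_id e
  mul_smul u u' e := comp_mk₀_comp e _ _
  smul_zero u := by
    change (0 : Ext.{w} Y K 1).comp (Ext.mk₀ (show K ⟶ K from u)) (add_zero 1) = 0
    rw [Ext.zero_comp]
  smul_add u e e' := Ext.add_comp e e' _ _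
  add_smul u u' e := by
    change e.comp (Ext.mk₀ ((show K ⟶ K from u) + (show K ⟶ K from u'))) (add_zero 1) = _
    rw [Ext.mk₀_add, Ext.comp_add]
    rfl
  zero_smul e := by
    change e.comp (Ext.mk₀ (0 : K ⟶ K)) (add_zero 1) = 0
    rw [Ext.mk₀_zero, Ext.comp_zero]

lemma end_smul_ext {Y K : A} (u : End K) (e : Ext.{w} Y K 1) :
    u • e = e.comp (Ext.mk₀ (show K ⟶ K from u)) (add_zero 1) := rfl

instance (k : Type t) [CommRing k] [Linear k A] (Y K : A) :
    IsScalarTower k (End K) (Ext.{w} Y K 1) where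
  smul_assoc a u e := by
    change e.comp (Ext.mk₀ (a • (show K ⟶ K from u))) (add_zero 1) =
      a • e.comp (Ext.mk₀ (show K ⟶ K from u)) (add_zero 1)
    rw [Ext.mk₀_smul, Ext.comp_smul]

/-- The stable morphisms: `Hom(C, Y)` modulo the projectively trivial ones. -/
abbrev StableHom (C Y : A) : Type v := (toStable.{w} A).obj C ⟶ (toStable.{w} A).obj Y

/-- The left `Γ(C)ᵒᵖ`-module structure on the stable morphisms, by precomposition. -/
instance stableHomModule (C Y : A) : Module (End C)ᵐᵒᵖ (StableHom.{w} C Y) where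
  smul s f := (toStable.{w} A).map (show C ⟶ C from s.unop) ≫ f
  one_smul f := by
    change (toStable.{w} A).map (𝟙 C) ≫ f = f
    rw [(toStable.{w} A).map_id, Category.id_comp]
  mul_smul s s' f := by
    change (toStable.{w} A).map ((show C ⟶ C from s.unop) ≫ (show C ⟶ C from s'.unop)) ≫ f =
      (toStable.{w} A).map (show C ⟶ C from s.unop) ≫
        ((toStable.{w} A).map (show C ⟶ C from s'.unop) ≫ f)
    rw [(toStable.{w} A).map_comp, Category.assoc]
  smul_zero s := Limits.comp_zero
  smul_add s f f' := Preadditive.comp_add _ _ _ _ _ _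
  add_smul s s' f := by
    change (toStable.{w} A).map ((show C ⟶ C from s.unop) + (show C ⟶ C from s'.unop)) ≫ f = _
    rw [(toStable.{w} A).map_add, Preadditive.add_comp]
    rfl
  zero_smul f := by
    change (toStable.{w} A).map (0 : C ⟶ C) ≫ f = 0
    rw [(toStable.{w} A).map_zero, Limits.zero_comp]

lemma op_end_smul_stableHom {C Y : A} (s : (End C)ᵐᵒᵖ) (f : StableHom.{w} C Y) :
    s • f = ((toStable.{w} A).map (show C ⟶ C from s.unop) ≫ f :) := rfl

/-! ### The map `η` -/

/-- The map from stable morphisms `C ⟶ X` to stable morphisms `C ⟶ Y` given by composition with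
`α : X ⟶ Y`. -/
def stablePostcomp (C : A) {X Y : A} (α : X ⟶ Y) :
    StableHom.{w} C X →ₗ[(End C)ᵐᵒᵖ] StableHom.{w} C Y where
  toFun f := f ≫ (toStable.{w} A).map α
  map_add' _ _ := Preadditive.add_comp _ _ _ _ _ _
  map_smul' _ _ := Category.assoc _ _ _

lemma range_stablePostcomp_mono (C : A) {Y : A} {α α' : EpiTo Y} (h : α ≤ α') :
    LinearMap.range (stablePostcomp.{w} C α.hom) ≤ LinearMap.range (stablePostcomp.{w} C α'.hom) := by
  obtain ⟨g, hg⟩ := h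
  rintro _ ⟨f, rfl⟩
  refine ⟨stablePostcomp.{w} C g f, ?_⟩
  rw [← hg]
  change (_ ≫ _) ≫ _ = _ ≫ (toStable.{w} A).map (g ≫ α'.hom)
  rw [(toStable.{w} A).map_comp, Category.assoc]

/-- `η_{C,Y}` sends the class of `α` to the image of composition with `α` on stable morphisms
from `C`. -/
def eta (C Y : A) (q : EpiClass Y) : Submodule (End C)ᵐᵒᵖ (StableHom.{w} C Y) :=
  Quotient.liftOn q (fun α => LinearMap.range (stablePostcomp.{w} C α.hom)) fun _ _ h =>
    le_antisymm (range_stablePostcomp_mono C h.1) (range_stablePostcomp_mono C h.2)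

/-! ### The map `δ` -/

/-- The class in `Ext¹(Y, Ker α)` of the exact sequence `0 ⟶ Ker α ⟶ X ⟶ Y ⟶ 0`. -/
def kernelClass {Y : A} (α : EpiTo Y) : Ext.{w} Y (kernel α.hom) 1 :=
  (kernelSequence_shortExact α).extClass

/-- The connecting map `c(ξ, K) : Hom(K', K) ⟶ Ext¹(Y, K)` of an extension class `ξ` of `Y` by
`K'`, which sends `u` to the class of the pushout of `ξ` along `u`. -/
def connecting {Y K' : A} (ξ : Ext.{w} Y K' 1) (K : A) : (K' ⟶ K) →ₗ[End K] Ext.{w} Y K 1 where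
  toFun u := ξ.comp (Ext.mk₀ u) (add_zero 1)
  map_add' u u' := by rw [Ext.mk₀_add, Ext.comp_add]
  map_smul' s u := comp_mk₀_comp ξ u s

lemma range_connecting_anti (K : A) {Y : A} {α α' : EpiTo Y} (h : α ≤ α') :
    LinearMap.range (connecting (kernelClass.{w} α') K) ≤
      LinearMap.range (connecting (kernelClass.{w} α) K) := by
  obtain ⟨g, hg⟩ := h
  let φ : kernelSequence α ⟶ kernelSequence α' :=
    { τ₁ := kernel.map α.hom α'.hom g (𝟙 Y) (by rw [hg, Category.comp_id])
      τ₂ := g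
      τ₃ := 𝟙 Y
      comm₁₂ := kernel.lift_ι _ _ _
      comm₂₃ := by
        change g ≫ α'.hom = α.hom ≫ 𝟙 Y
        rw [hg, Category.comp_id] }
  have key : (kernelClass.{w} α).comp (Ext.mk₀ φ.τ₁) (add_zero 1) = kernelClass.{w} α' := by
    have := ShortComplex.ShortExact.extClass_naturality (kernelSequence_shortExact α)
      (kernelSequence_shortExact α') φ
    refine this.trans ?_
    exact Ext.mk₀_id_comp _
  rintro _ ⟨u, rfl⟩
  refine ⟨φ.τ₁ ≫ u, ?_⟩
  change (kernelClass.{w} α).comp (Ext.mk₀ (φ.τ₁ ≫ u)) (add_zero 1) =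
    (kernelClass.{w} α').comp (Ext.mk₀ u) (add_zero 1)
  exact (comp_mk₀_comp _ _ _).trans (congrArg (fun e => Ext.comp e (Ext.mk₀ u) (add_zero 1)) key)

/-- `δ_{K,Y}` sends the class of `α` to the image of the connecting map `c(ξ_α, K)`, where `ξ_α`
is the exact sequence `0 ⟶ Ker α ⟶ X ⟶ Y ⟶ 0`. -/
def delta (K Y : A) (q : EpiClass Y) : Submodule (End K) (Ext.{w} Y K 1) :=
  Quotient.liftOn q (fun α => LinearMap.range (connecting (kernelClass.{w} α) K)) fun _ _ h =>
    le_antisymm (range_connecting_anti K h.2) (range_connecting_anti K h.1)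

end Abelian

/-! ### Auslander-Reiten duality -/

/-- Auslander-Reiten duality for `A`, where `D = Hom_k(-, E)`: a `k`-linear equivalence `τ` from the
stable to the costable category, with its quasi-inverse, and `k`-linear isomorphisms from
`D Ext¹(X, Y)` to the costable morphisms `Y ⟶ τ X`, functorial in `X` and `Y`. -/
structure ARDuality (k : Type t) [CommRing k] (A : Type u) [Category.{v} A] [Abelian A]
    [Linear k A] [HasExt.{w} A] (E : Type t) [AddCommGroup E] [Module k E] where
  τ : Stable.{w} A ≌ Costable.{w} A
  additive : τ.functor.Additive
  linear : τ.functor.Linear k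
  Φ (X Y : A) : (Ext.{w} X Y 1 →ₗ[k] E) ≃ₗ[k]
    ((toCostable.{w} A).obj Y ⟶ τ.functor.obj ((toStable.{w} A).obj X))
  Φ_naturality_left {X X' : A} (Y : A) (f : X ⟶ X') (θ : Ext.{w} X Y 1 →ₗ[k] E) :
    Φ X' Y (θ ∘ₗ (Ext.mk₀ f).precompOfLinear k Y (zero_add 1)) =
      Φ X Y θ ≫ τ.functor.map ((toStable.{w} A).map f)
  Φ_naturality_right (X : A) {Y Y' : A} (g : Y' ⟶ Y) (θ : Ext.{w} X Y 1 →ₗ[k] E) :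
    Φ X Y' (θ ∘ₗ (Ext.mk₀ g).postcompOfLinear k X (add_zero 1)) =
      (toCostable.{w} A).map g ≫ Φ X Y θ

namespace ARDuality

variable {k : Type t} [CommRing k] {A : Type u} [Category.{v} A] [Abelian A] [Linear k A]
  [HasExt.{w} A] {E : Type t} [AddCommGroup E] [Module k E] (T : ARDuality.{w} k A E)

/-- The object `τ⁻¹ K`. -/
def tauInv (K : A) : A := (T.τ.inverse.obj ((toCostable.{w} A).obj K)).as

/-- The isomorphism which applies `τ⁻¹` to a costable morphism `K ⟶ τ Y` and then composes with
`ε : τ⁻¹ τ Y ⟶ Y`. -/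
def tauInvHom (K Y : A) :
    ((toCostable.{w} A).obj K ⟶ T.τ.functor.obj ((toStable.{w} A).obj Y)) ≃ₗ[k]
      StableHom.{w} (T.tauInv K) Y where
  toFun g := (T.τ.inverse.map g ≫ T.τ.unitIso.inv.app ((toStable.{w} A).obj Y) :)
  map_add' g g' := by
    have := T.additive
    change T.τ.inverse.map (g + g') ≫ _ = T.τ.inverse.map g ≫ _ + T.τ.inverse.map g' ≫ _
    rw [Functor.map_add, Preadditive.add_comp]
    rfl
  map_smul' a g := by
    have := T.additive
    have := T.linear
    change T.τ.inverse.map (a • g) ≫ _ = a • (T.τ.inverse.map g ≫ _)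
    rw [Functor.map_smul, Linear.smul_comp]
  invFun f := T.τ.inverse.preimage
    ((f : T.τ.inverse.obj ((toCostable.{w} A).obj K) ⟶ (toStable.{w} A).obj Y) ≫
      T.τ.unitIso.hom.app ((toStable.{w} A).obj Y))
  left_inv g := by
    apply T.τ.inverse.map_injective
    rw [Functor.map_preimage]
    change (T.τ.inverse.map g ≫ T.τ.unitIso.inv.app _) ≫ T.τ.unitIso.hom.app _ = _
    rw [Category.assoc, Iso.inv_hom_id_app]
    exact Category.comp_id _
  right_inv f := by
    change T.τ.inverse.map (T.τ.inverse.preimage _) ≫ _ = _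
    rw [Functor.map_preimage]
    refine (Category.assoc _ _ _).trans ?_
    rw [Iso.hom_inv_id_app]
    exact Category.comp_id _

/-- The isomorphism `Ψ_{Y,K}` from `D Ext¹(Y, K)` to the stable morphisms `τ⁻¹ K ⟶ Y`. -/
def Psi (Y K : A) : (Ext.{w} Y K 1 →ₗ[k] E) ≃ₗ[k] StableHom.{w} (T.tauInv K) Y :=
  (T.Φ Y K).trans (T.tauInvHom K Y)

/-- The map `ψ = D(inc') ∘ Ψ⁻¹` from the stable morphisms `τ⁻¹ K ⟶ Y` to `D L`, where `inc'` is the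
inclusion of the `Γ(K)`-submodule `L` in `Ext¹(Y, K)`. -/
def psi {K Y : A} (L : Submodule (End K) (Ext.{w} Y K 1)) :
    StableHom.{w} (T.tauInv K) Y →ₗ[k] (L.restrictScalars k →ₗ[k] E) :=
  (LinearMap.lcomp k E (L.restrictScalars k).subtype) ∘ₗ (T.Psi Y K).symm.toLinearMap

lemma psi_apply {K Y : A} (L : Submodule (End K) (Ext.{w} Y K 1))
    (f : StableHom.{w} (T.tauInv K) Y) (x : L.restrictScalars k) :
    T.psi L f x = (T.Psi Y K).symm f x := rfl

lemma Psi_naturality_right {Y K : A} (g : K ⟶ K) (θ : Ext.{w} Y K 1 →ₗ[k] E) :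
    T.Psi Y K (θ ∘ₗ (Ext.mk₀ g).postcompOfLinear k Y (add_zero 1)) =
      (T.τ.inverse.map ((toCostable.{w} A).map g) ≫ (T.Psi Y K θ :
        T.τ.inverse.obj ((toCostable.{w} A).obj K) ⟶ (toStable.{w} A).obj Y) :) := by
  change T.τ.inverse.map (T.Φ Y K _) ≫ _ = _ ≫ T.τ.inverse.map (T.Φ Y K θ) ≫ _
  rw [T.Φ_naturality_right, Functor.map_comp, Category.assoc]

/-- `γ_{K,Y}` sends a `Γ(K)`-submodule `L` of `Ext¹(Y, K)` to the kernel of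
`ψ = D(inc') ∘ Ψ⁻¹`, which is a `Γ(τ⁻¹ K)ᵒᵖ`-submodule of the stable morphisms `τ⁻¹ K ⟶ Y`. -/
def gamma (K Y : A) (L : Submodule (End K) (Ext.{w} Y K 1)) :
    Submodule (End (T.tauInv K))ᵐᵒᵖ (StableHom.{w} (T.tauInv K) Y) where
  carrier := {f | T.psi L f = 0}
  add_mem' {f f'} h h' := by
    change T.psi L (f + f') = 0
    rw [map_add, show T.psi L f = 0 from h, show T.psi L f' = 0 from h', add_zero]
  zero_mem' := map_zero _
  smul_mem' s f h := by
    obtain ⟨t', ht'⟩ := T.τ.inverse.map_surjective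
      (X := (toCostable.{w} A).obj K) (Y := (toCostable.{w} A).obj K)
      ((toStable.{w} A).map (show T.tauInv K ⟶ T.tauInv K from s.unop))
    obtain ⟨g, rfl⟩ := (toCostable.{w} A).map_surjective t'
    obtain ⟨θ, rfl⟩ := (T.Psi Y K).surjective f
    have hs : s • T.Psi Y K θ =
        T.Psi Y K (θ ∘ₗ (Ext.mk₀ g).postcompOfLinear k Y (add_zero 1)) := by
      rw [Psi_naturality_right, ht']
      rfl
    change T.psi L (s • T.Psi Y K θ) = 0
    rw [hs]
    ext x
    have hx : (End.of g) • (x : Ext.{w} Y K 1) ∈ L := L.smul_mem _ x.2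
    have h0 := LinearMap.congr_fun (show T.psi L (T.Psi Y K θ) = 0 from h) ⟨_, hx⟩
    rw [psi_apply, LinearEquiv.symm_apply_apply] at h0 ⊢
    exact h0

end ARDuality

end

end ARTriangle

/-! Transporting along `Psi` turns everything into linear algebra on `D Ext¹(Y, K)`: `γ(L)` becomes
the annihilator of `L`, and naturality in `K` matches the two endomorphism actions, so submodules go
to submodules. That `γ` is an anti-isomorphism is then the double annihilator theorem. As `E`
cogenerates, linear forms separate points from submodules, so `γ` reflects inclusions
(`gamma_le_gamma_iff`). Surjectivity is a length count (`mem_of_forall_apply_eq_zero`) resting on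
the fact that `D` does not increase length. `Ext¹(Y, K)` is not assumed finitely generated: its dual
is, being isomorphic to a stable Hom space, and this already forces finite length. For the triangle,
the long exact sequence identifies `δ([α⟩)` with the kernel of the pullback `α^*` on `Ext¹(-, K)`,
while naturality in `Y` identifies `η([α⟩)` with the image of `D(α^*)`. As `E` is injective, this
image consists of the forms vanishing on `ker α^*`. -/

namespace ARTriangle

/-! ### Duality over a commutative artinian ring -/

namespace IsMinimalInjectiveCogenerator

variable {k : Type t} [CommRing k] {E : Type t} [AddCommGroup E] [Module k E]
  {M : Type*} [AddCommGroup M] [Module k M] {N : Type*} [AddCommGroup N] [Module k N]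

/-- Baer's criterion frees injectivity from the universe of the test modules. -/
lemma exists_extension (hE : IsMinimalInjectiveCogenerator k E) (i : M →ₗ[k] N)
    (hi : Function.Injective i) (f : M →ₗ[k] E) : ∃ g : N →ₗ[k] E, g ∘ₗ i = f :=
  (Module.Baer.iff_injective.2 hE.injective).extension_property i hi f

/-- A linear form which vanishes on the kernel of a linear map factors through this map. -/
lemma exists_comp_eq (hE : IsMinimalInjectiveCogenerator k E) (p : M →ₗ[k] N) (f : M →ₗ[k] E)
    (hf : LinearMap.ker p ≤ LinearMap.ker f) : ∃ g : N →ₗ[k] E, g ∘ₗ p = f := by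
  obtain ⟨g, hg⟩ := hE.exists_extension ((LinearMap.ker p).liftQ p le_rfl)
    (LinearMap.ker_eq_bot.1 (Submodule.ker_liftQ_eq_bot _ _ _ le_rfl))
    ((LinearMap.ker p).liftQ f hf)
  refine ⟨g, LinearMap.ext fun x => ?_⟩
  have := LinearMap.congr_fun hg (Submodule.Quotient.mk x)
  simpa using this

/-- The annihilator of `x` lies in a maximal ideal `m`, and `k / rad k` contains a copy of `k / m`;
so `kx` has a nonzero map to `E`, which extends to `M`. -/
lemma exists_apply_ne_zero [IsArtinianRing k] (hE : IsMinimalInjectiveCogenerator k E) {x : M}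
    (hx : x ≠ 0) : ∃ f : M →ₗ[k] E, f x ≠ 0 := by
  obtain ⟨i, hi, -⟩ := hE.exists_essential_embedding
  let p := LinearMap.toSpanSingleton k M x
  have hne : LinearMap.ker p ≠ ⊤ := fun h => by
    have h1 : (1 : k) ∈ LinearMap.ker p := h ▸ trivial
    exact hx (by simpa [p] using h1)
  obtain ⟨m, hm, hle⟩ := Ideal.exists_le_maximal _ hne
  -- The class of `y` spans the copy of `k / m`. Take `y` outside `m` but in all the other maximal
  -- ideals; since these are finitely many, prime avoidance for their intersection provides it.
  obtain ⟨y, hym, hy⟩ : ∃ y : k, y ∉ m ∧ ∀ a ∈ m, a * y ∈ Ring.jacobson k := by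
    let s : Finset (Ideal k) := (IsArtinianRing.setOfPred_isMaximal_finite k).toFinset.erase m
    have hs : ¬ s.inf id ≤ m := fun h => by
      obtain ⟨n, hn, hnm⟩ := (Ideal.IsPrime.inf_le' hm.isPrime).1 h
      have hn' : n ≠ m ∧ n.IsMaximal := by simpa [s] using hn
      exact hn'.1 (hn'.2.eq_of_le hm.ne_top hnm)
    obtain ⟨y, hy, hym⟩ := SetLike.not_le_iff_exists.1 hs
    refine ⟨y, hym, fun a ha => ?_⟩
    rw [Ring.jacobson_eq_sInf_isMaximal, Submodule.mem_sInf]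
    intro n hn
    by_cases hnm : n = m
    · exact Ideal.mul_mem_right _ _ (hnm ▸ ha)
    · exact Ideal.mul_mem_left _ _ (Finset.inf_le (f := id) (show n ∈ s by simpa [s] using ⟨hnm, hn⟩) hy)
  let q : k →ₗ[k] E := LinearMap.toSpanSingleton k E (i (Submodule.Quotient.mk y))
  obtain ⟨g, hg⟩ := hE.exists_comp_eq p q fun a ha => by
    have := (Submodule.Quotient.mk_eq_zero _).2 (hy a (hle ha))
    rw [LinearMap.mem_ker, LinearMap.toSpanSingleton_apply, ← map_smul,
      ← Submodule.Quotient.mk_smul, smul_eq_mul, this, map_zero]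
  refine ⟨g, fun h0 => hym ?_⟩
  have h1 := LinearMap.congr_fun hg 1
  simp only [LinearMap.comp_apply, p, q, LinearMap.toSpanSingleton_apply, one_smul, h0] at h1
  have h2 := (Submodule.Quotient.mk_eq_zero _).1 ((map_eq_zero_iff i hi).1 h1.symm)
  rw [Ring.jacobson_eq_sInf_isMaximal, Submodule.mem_sInf] at h2
  exact h2 m hm

lemma exists_apply_ne_zero_of_notMem [IsArtinianRing k] (hE : IsMinimalInjectiveCogenerator k E)
    (L : Submodule k M) {x : M} (hx : x ∉ L) : ∃ f : M →ₗ[k] E, L ≤ LinearMap.ker f ∧ f x ≠ 0 := by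
  obtain ⟨f, hf⟩ := hE.exists_apply_ne_zero (x := L.mkQ x) (by simpa using hx)
  exact ⟨f ∘ₗ L.mkQ, fun y hy => by simp [(Submodule.Quotient.mk_eq_zero L).2 hy], hf⟩

/-- Minimality of `E` enters here: the image of a nonzero form on a simple module meets the
essential submodule `k / rad k`, hence lies in it. Values at a generator `x` can thus be compared
inside `k / rad k`. -/
lemma exists_eq_smul_of_isSimpleModule (hE : IsMinimalInjectiveCogenerator k E)
    [IsSimpleModule k M] {f : M →ₗ[k] E} (hf : f ≠ 0) (g : M →ₗ[k] E) : ∃ c : k, c • f = g := by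
  obtain ⟨i, hi, hess⟩ := hE.exists_essential_embedding
  obtain ⟨x, hx⟩ : ∃ x : M, f x ≠ 0 := by
    by_contra! h
    exact hf (LinearMap.ext h)
  have hx0 : x ≠ 0 := fun h => hx (by rw [h, map_zero])
  have hspan := IsSimpleModule.toSpanSingleton_surjective k hx0
  have hinv (r : k) (hr : r • x ≠ 0) : ∃ s : k, s • r • x = x :=
    IsSimpleModule.toSpanSingleton_surjective k hr x
  have hrange (h : M →ₗ[k] E) : ∃ y : k, h x = i (Submodule.Quotient.mk y) := by
    by_cases h0 : h = 0
    · exact ⟨0, by simp [h0]⟩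
    · obtain ⟨e, ⟨⟨z, rfl⟩, hz⟩, he⟩ := Submodule.exists_mem_ne_zero_of_ne_bot
        (hess (LinearMap.range h) (by rwa [ne_eq, LinearMap.range_eq_bot]))
      have hz0 : z ≠ 0 := fun h => he (by rw [h, map_zero])
      obtain ⟨s, hs⟩ := IsSimpleModule.toSpanSingleton_surjective k hz0 x
      obtain ⟨y, hy⟩ := hz
      obtain ⟨y, rfl⟩ := Submodule.Quotient.mk_surjective _ y
      refine ⟨s * y, ?_⟩
      rw [← hs, LinearMap.toSpanSingleton_apply, map_smul, ← hy, ← map_smul]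
      rfl
  have htors (h : M →ₗ[k] E) (y a : k) (hy : h x = i (Submodule.Quotient.mk y)) (ha : a • x = 0) :
      a * y ∈ Ring.jacobson k := by
    rw [← Submodule.Quotient.mk_eq_zero, ← map_eq_zero_iff i hi, ← smul_eq_mul,
      Submodule.Quotient.mk_smul, map_smul, ← hy, ← map_smul, ha, map_zero]
  obtain ⟨y, hy⟩ := hrange f
  obtain ⟨z, hz⟩ := hrange g
  -- If `y` killed `x`, it would kill `f x`, so `y²` would lie in the radical ideal `rad k`, forcing
  -- `f x = 0`.
  have hyx : y • x ≠ 0 := fun h0 => hx (by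
    have : y ∈ Ring.jacobson k := by
      rw [← Ideal.jacobson_bot]
      refine Ideal.isRadical_jacobson _ ⟨2, ?_⟩
      rw [Ideal.jacobson_bot, sq]
      exact htors f y y hy h0
    rw [hy, (Submodule.Quotient.mk_eq_zero _).2 this, map_zero])
  obtain ⟨s, hs⟩ := hinv y hyx
  -- Since `1 - s * y` kills `x`, it kills `g x`; hence `z` and `z * s * y` agree modulo `rad k`,
  -- and `z * s` is the required scalar.
  have h1 : (1 - s * y) * z ∈ Ring.jacobson k :=
    htors g z _ hz (by rw [sub_smul, one_smul, mul_smul, hs, sub_self])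
  have h2 : ((z * s) • f) x = g x := by
    rw [LinearMap.smul_apply, hy, hz, ← map_smul, ← Submodule.Quotient.mk_smul]
    refine congrArg i ((Submodule.Quotient.eq _).2 ?_)
    rw [← neg_mem_iff]
    convert h1 using 1
    simp only [smul_eq_mul]
    ring
  refine ⟨z * s, LinearMap.ext fun x' => ?_⟩
  obtain ⟨r, rfl⟩ := hspan x'
  rw [LinearMap.toSpanSingleton_apply, map_smul, map_smul, h2]

lemma length_dual_le_one_of_isSimpleModule (hE : IsMinimalInjectiveCogenerator k E)
    [IsSimpleModule k M] : Module.length k (M →ₗ[k] E) ≤ 1 := by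
  cases subsingleton_or_nontrivial (M →ₗ[k] E)
  · rw [Module.length_eq_zero]
    exact zero_le_one
  · have : IsSimpleModule k (M →ₗ[k] E) := isSimpleModule_iff_toSpanSingleton_surjective.2
      ⟨inferInstance, fun f hf g => hE.exists_eq_smul_of_isSimpleModule hf g⟩
    exact (Module.length_eq_one k _).le

/-- Induction along a composition series. Left exactness of `D` suffices for the inequality, so
restriction to `N` is only corestricted to its range. -/
lemma length_dual_le (hE : IsMinimalInjectiveCogenerator k E) (hM : IsFiniteLength k M) :
    Module.length k (M →ₗ[k] E) ≤ Module.length k M := by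
  induction hM with
  | of_subsingleton => rw [Module.length_eq_zero]; exact bot_le
  | @of_simple_quotient M _ _ N _ _ ih =>
    let f : ((M ⧸ N) →ₗ[k] E) →ₗ[k] (M →ₗ[k] E) := LinearMap.lcomp k E N.mkQ
    let g : (M →ₗ[k] E) →ₗ[k] (N →ₗ[k] E) := LinearMap.lcomp k E N.subtype
    have hf : Function.Injective f := fun a b h => Submodule.linearMap_qext N h
    have hfg : Function.Exact f g.rangeRestrict := fun a => by
      refine ⟨fun h => ?_, ?_⟩
      · have h' : g a = 0 := congrArg Subtype.val h
        have hN : N ≤ LinearMap.ker a := fun x hx => LinearMap.congr_fun h' ⟨x, hx⟩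
        exact ⟨N.liftQ a hN, N.liftQ_mkQ a hN⟩
      · rintro ⟨b, rfl⟩
        ext x
        change b (N.mkQ x) = 0
        rw [Submodule.mkQ_apply, (Submodule.Quotient.mk_eq_zero N).2 x.2, map_zero]
    rw [Module.length_eq_add_of_exact f g.rangeRestrict hf g.surjective_rangeRestrict hfg,
      Module.length_eq_add_of_exact N.subtype N.mkQ N.subtype_injective N.mkQ_surjective
        (LinearMap.exact_subtype_mkQ N), add_comm, Module.length_eq_one k (M ⧸ N)]
    exact add_le_add ((Module.length_le_of_injective _ (LinearMap.range g).subtype_injective).trans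
      ih) hE.length_dual_le_one_of_isSimpleModule

/-- The linear forms which vanish on a submodule. -/
def annihilator (E : Type*) [AddCommGroup E] [Module k E] (L : Submodule k M) :
    Submodule k (M →ₗ[k] E) :=
  LinearMap.ker (LinearMap.lcomp k E L.subtype)

lemma mem_annihilator {L : Submodule k M} {f : M →ₗ[k] E} :
    f ∈ annihilator E L ↔ ∀ x ∈ L, f x = 0 := by
  simp [annihilator, LinearMap.ext_iff]

lemma annihilator_le_annihilator_iff [IsArtinianRing k] (hE : IsMinimalInjectiveCogenerator k E)
    {L L' : Submodule k M} : annihilator E L' ≤ annihilator E L ↔ L ≤ L' := by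
  refine ⟨fun h x hx => ?_, fun h f hf => mem_annihilator.2 fun x hx => mem_annihilator.1 hf x (h hx)⟩
  by_contra hx'
  obtain ⟨f, hf, hfx⟩ := hE.exists_apply_ne_zero_of_notMem L' hx'
  exact hfx (mem_annihilator.1 (h (mem_annihilator.2 hf)) x hx)

/-- A module with a finitely generated dual has finite length. -/
lemma isFiniteLength_of_finite_dual [IsArtinianRing k] (hE : IsMinimalInjectiveCogenerator k E)
    [Module.Finite k (M →ₗ[k] E)] : IsFiniteLength k M := by
  -- The dual is finitely generated over an artinian ring, so it satisfies both chain conditions;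
  -- the order-reversing embedding carries them over to `M`.
  let φ : Submodule k M ↪o (Submodule k (M →ₗ[k] E))ᵒᵈ :=
    OrderEmbedding.ofMapLEIff (fun L => OrderDual.toDual (annihilator E L))
      fun _ _ => hE.annihilator_le_annihilator_iff
  rw [isFiniteLength_iff_isNoetherian_isArtinian]
  constructor
  · rw [isNoetherian_iff']
    exact φ.strictMono.wellFoundedGT
  · exact φ.strictMono.wellFoundedLT

/-- A submodule of the dual of a module of finite length is the annihilator of its common
kernel. -/
lemma mem_of_forall_apply_eq_zero (hE : IsMinimalInjectiveCogenerator k E)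
    [IsArtinianRing k] [Module.Finite k (M →ₗ[k] E)] (H : Submodule k (M →ₗ[k] E))
    {f : M →ₗ[k] E} (hf : ∀ x, (∀ h ∈ H, h x = 0) → f x = 0) : f ∈ H := by
  have hM : IsFiniteLength k M := hE.isFiniteLength_of_finite_dual
  let ev : M →ₗ[k] (H →ₗ[k] E) := H.subtype.flip
  let L := LinearMap.ker ev
  have hL (x : M) : x ∈ L ↔ ∀ h ∈ H, h x = 0 := by
    simp [L, ev, LinearMap.ext_iff]
  have hHL : H ≤ annihilator E L := fun h hh => mem_annihilator.2 fun x hx => (hL x).1 hx h hh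
  have hfL : f ∈ annihilator E L := mem_annihilator.2 fun x hx => hf x ((hL x).1 hx)
  let ι : annihilator E L →ₗ[k] ((M ⧸ L) →ₗ[k] E) :=
    { toFun h := L.liftQ h.1 fun x hx => mem_annihilator.1 h.2 x hx
      map_add' _ _ := by ext; rfl
      map_smul' _ _ := by ext; rfl }
  have hι : Function.Injective ι := fun a b hab => by
    ext x
    exact LinearMap.congr_fun hab (Submodule.Quotient.mk x)
  have hH : IsFiniteLength k H :=
    isFiniteLength_iff_isNoetherian_isArtinian.2 ⟨inferInstance, inferInstance⟩
  -- Evaluation embeds `M / L` into `D H`, and annihilating forms descend to `M / L`, so two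
  -- applications of the length bound close the chain. With `H` inside the annihilator, finite
  -- length leaves only equality.
  have hle : Module.length k (annihilator E L) ≤ Module.length k H :=
    calc _ ≤ _ := Module.length_le_of_injective ι hι
      _ ≤ Module.length k (M ⧸ L) := hE.length_dual_le (hM.of_surjective L.mkQ_surjective)
      _ ≤ Module.length k (H →ₗ[k] E) := Module.length_le_of_injective (L.liftQ ev le_rfl)
          (LinearMap.ker_eq_bot.1 (Submodule.ker_liftQ_eq_bot _ _ _ le_rfl))
      _ ≤ _ := hE.length_dual_le hH
  obtain heq | hlt := hHL.eq_or_lt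
  · exact heq ▸ hfL
  · rw [← not_lt, Module.length_submodule, Module.length_submodule] at hle
    exact (hle (Submodule.height_strictMono hlt)).elim

end IsMinimalInjectiveCogenerator

/-! ### Pullback of extensions and stable morphisms -/

section

variable {A : Type u} [Category.{v} A] [Abelian A] [HasExt.{w} A]

/-- The image of the connecting map of an exact sequence `0 ⟶ Ker α ⟶ X ⟶ Y ⟶ 0` is the kernel of
the pullback along `α`. -/
lemma mem_range_connecting_kernelClass_iff {Y : A} (α : EpiTo Y) (K : A) (e : Ext.{w} Y K 1) :
    e ∈ LinearMap.range (connecting (kernelClass.{w} α) K) ↔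
      (Ext.mk₀ α.hom).comp e (zero_add 1) = 0 := by
  constructor
  · rintro ⟨u, rfl⟩
    exact (kernelSequence_shortExact α).comp_extClass_assoc (Ext.mk₀ u) (add_zero 1)
  · intro he
    obtain ⟨x, hx⟩ := Ext.contravariant_sequence_exact₃ (kernelSequence_shortExact α) K e he
      (add_zero 1)
    obtain ⟨u, rfl⟩ := (Ext.mk₀_bijective _ _).2 x
    exact ⟨u, hx⟩

variable {k : Type t} [CommRing k] [Linear k A]

/-- This makes submodules over the endomorphism ring `k`-submodules, to which duality and chain
conditions over `k` apply. -/
instance (C Y : A) : IsScalarTower k (End C)ᵐᵒᵖ (StableHom.{w} C Y) where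
  smul_assoc a s f := by
    change (toStable.{w} A).map (a • (show C ⟶ C from s.unop)) ≫ f =
      a • ((toStable.{w} A).map (show C ⟶ C from s.unop) ≫ f)
    rw [← Linear.smul_comp]
    rfl

lemma finite_stableHom (C Y : A) [Module.Finite k (C ⟶ Y)] :
    Module.Finite k (StableHom.{w} C Y) :=
  .of_surjective
    ({ toFun := (toStable.{w} A).map
       map_add' _ _ := rfl
       map_smul' _ _ := rfl } : (C ⟶ Y) →ₗ[k] StableHom.{w} C Y)
    (toStable.{w} A).map_surjective

end

/-! ### The anti-isomorphism and the commuting triangle -/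

namespace ARDuality

variable {k : Type t} [CommRing k] {A : Type u} [Category.{v} A] [Abelian A] [Linear k A]
  [HasExt.{w} A] {E : Type t} [AddCommGroup E] [Module k E] (T : ARDuality.{w} k A E)

/-- Naturality of `Φ` combined with naturality of `ε : τ⁻¹ τ ⟶ Id`. -/
lemma Psi_naturality_left {X Y : A} (K : A) (f : X ⟶ Y) (θ : Ext.{w} X K 1 →ₗ[k] E) :
    T.Psi Y K (θ ∘ₗ (Ext.mk₀ f).precompOfLinear k K (zero_add 1)) =
      stablePostcomp.{w} (T.tauInv K) f (T.Psi X K θ) := by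
  change T.τ.inverse.map (T.Φ Y K _) ≫ _ =
    (T.τ.inverse.map (T.Φ X K θ) ≫ T.τ.unitIso.inv.app ((toStable.{w} A).obj X)) ≫
      (toStable.{w} A).map f
  rw [T.Φ_naturality_left, Functor.map_comp, Category.assoc, Category.assoc]
  exact congrArg _ (T.τ.unitIso.inv.naturality ((toStable.{w} A).map f))

lemma mem_gamma_iff {K Y : A} {L : Submodule (End K) (Ext.{w} Y K 1)}
    {f : StableHom.{w} (T.tauInv K) Y} :
    f ∈ T.gamma K Y L ↔ ∀ x ∈ L, (T.Psi Y K).symm f x = 0 :=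
  (LinearMap.ext_iff (f := T.psi L f) (g := 0)).trans Subtype.forall

lemma Psi_mem_gamma_iff {K Y : A} {L : Submodule (End K) (Ext.{w} Y K 1)}
    {θ : Ext.{w} Y K 1 →ₗ[k] E} : T.Psi Y K θ ∈ T.gamma K Y L ↔ ∀ x ∈ L, θ x = 0 := by
  rw [mem_gamma_iff, LinearEquiv.symm_apply_apply]

lemma finite_dual_ext (K Y : A) [Module.Finite k (T.tauInv K ⟶ Y)] :
    Module.Finite k (Ext.{w} Y K 1 →ₗ[k] E) :=
  have := finite_stableHom.{w} (k := k) (T.tauInv K) Y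
  .equiv (T.Psi Y K).symm

lemma gamma_le_gamma_iff [IsArtinianRing k] (hE : IsMinimalInjectiveCogenerator k E) {K Y : A}
    {L L' : Submodule (End K) (Ext.{w} Y K 1)} : T.gamma K Y L' ≤ T.gamma K Y L ↔ L ≤ L' := by
  refine ⟨fun h x hx => ?_, fun h f hf => ?_⟩
  · by_contra hx'
    obtain ⟨θ, hθ, hθx⟩ := hE.exists_apply_ne_zero_of_notMem (L'.restrictScalars k) hx'
    exact hθx (T.Psi_mem_gamma_iff.1 (h (T.Psi_mem_gamma_iff.2 hθ)) x hx)
  · exact T.mem_gamma_iff.2 fun x hx => T.mem_gamma_iff.1 hf x (h hx)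

/-- The common kernel in `Ext¹(Y, K)` of the linear forms that correspond to the elements of a
`Γ(τ⁻¹ K)ᵒᵖ`-submodule of the stable morphisms `τ⁻¹ K ⟶ Y`. -/
def commonKernel {K Y : A} (H : Submodule (End (T.tauInv K))ᵐᵒᵖ (StableHom.{w} (T.tauInv K) Y)) :
    Submodule (End K) (Ext.{w} Y K 1) where
  carrier := {x | ∀ f ∈ H, (T.Psi Y K).symm f x = 0}
  add_mem' hx hy f hf := by rw [map_add, hx f hf, hy f hf, add_zero]
  zero_mem' _ _ := map_zero _
  smul_mem' g x hx f hf := by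
    -- Under `Psi`, the dual of pushout along `g` is precomposition with `τ⁻¹ g`; a lift `s` of `τ⁻¹
    -- g` to `A` acts on `H`.
    obtain ⟨s, hs⟩ := (toStable.{w} A).map_surjective (X := T.tauInv K) (Y := T.tauInv K)
      (T.τ.inverse.map ((toCostable.{w} A).map (show K ⟶ K from g)))
    obtain ⟨θ, rfl⟩ := (T.Psi Y K).surjective f
    have h := hx _ (H.smul_mem (MulOpposite.op (End.of s)) hf)
    have hsθ : MulOpposite.op (End.of s) • T.Psi Y K θ =
        T.Psi Y K (θ ∘ₗ (Ext.mk₀ (show K ⟶ K from g)).postcompOfLinear k Y (add_zero 1)) := by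
      rw [Psi_naturality_right, ← hs]
      rfl
    rw [hsθ, LinearEquiv.symm_apply_apply] at h
    rw [LinearEquiv.symm_apply_apply]
    exact h

/-- Surjectivity of `γ`: the double annihilator property over `k`, applied to the preimage of `H`
under `Psi`. -/
lemma gamma_commonKernel [IsArtinianRing k] (hE : IsMinimalInjectiveCogenerator k E) {K Y : A}
    [Module.Finite k (T.tauInv K ⟶ Y)]
    (H : Submodule (End (T.tauInv K))ᵐᵒᵖ (StableHom.{w} (T.tauInv K) Y)) :
    T.gamma K Y (T.commonKernel H) = H := by
  have := T.finite_dual_ext K Y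
  ext f
  obtain ⟨θ, rfl⟩ := (T.Psi Y K).surjective f
  rw [Psi_mem_gamma_iff]
  refine ⟨fun h => ?_, fun h x hx => ?_⟩
  · refine hE.mem_of_forall_apply_eq_zero
      ((H.restrictScalars k).comap (T.Psi Y K).toLinearMap) fun x hx => h x fun f hf => hx _ ?_
    simpa using hf
  · simpa using hx _ h

/-- Through `Psi`, one side says that `θ` factors through pullback along `α`, the other that `θ`
vanishes on its kernel; injectivity of `E` makes these equivalent. -/
lemma eta_eq_gamma_delta (hE : IsMinimalInjectiveCogenerator k E) (K Y : A) (q : EpiClass Y) :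
    eta.{w} (T.tauInv K) Y q = T.gamma K Y (delta.{w} K Y q) := by
  induction q using Quotient.inductionOn with | _ α
  ext f
  obtain ⟨θ, rfl⟩ := (T.Psi Y K).surjective f
  rw [Psi_mem_gamma_iff]
  change _ ∈ LinearMap.range (stablePostcomp.{w} (T.tauInv K) α.hom) ↔
    ∀ x ∈ LinearMap.range (connecting (kernelClass.{w} α) K), θ x = 0
  simp only [mem_range_connecting_kernelClass_iff]
  constructor
  · rintro ⟨f, hf⟩ x hx
    obtain ⟨θ', rfl⟩ := (T.Psi α.source K).surjective f
    rw [← Psi_naturality_left, (T.Psi Y K).injective.eq_iff] at hf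
    rw [← hf]
    change θ' ((Ext.mk₀ α.hom).comp x (zero_add 1)) = 0
    rw [hx, map_zero]
  · intro h
    obtain ⟨θ', rfl⟩ := hE.exists_comp_eq
      ((Ext.mk₀ α.hom).precompOfLinear k K (zero_add 1)) θ h
    exact ⟨T.Psi α.source K θ', (T.Psi_naturality_left K α.hom θ').symm⟩

end ARDuality

end ARTriangle

theorem proposition4p3 {k : Type t} [CommRing k] [IsArtinianRing k]
    {E : Type t} [AddCommGroup E] [Module k E]
    (hE : ARTriangle.IsMinimalInjectiveCogenerator k E)
    {A : Type u} [Category.{v} A] [Abelian A] [Linear k A] [HasExt.{w} A]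
    (homFinite : ∀ X Y : A, Module.Finite k (X ⟶ Y))
    (T : ARTriangle.ARDuality.{w} k A E) (K Y : A) :
    -- every submodule is finitely generated, so that `Sub` and `sub` agree on both sides
    (∀ L : Submodule (End K) (Ext.{w} Y K 1), L.FG) ∧
    (∀ H : Submodule (End (T.tauInv K))ᵐᵒᵖ (ARTriangle.StableHom.{w} (T.tauInv K) Y), H.FG) ∧
    -- `γ` is an anti-isomorphism of posets
    Function.Bijective (T.gamma K Y) ∧
    (∀ L L' : Submodule (End K) (Ext.{w} Y K 1), T.gamma K Y L' ≤ T.gamma K Y L ↔ L ≤ L') ∧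
    -- the triangle commutes
    (∀ q : ARTriangle.EpiClass Y,
      ARTriangle.eta.{w} (T.tauInv K) Y q = T.gamma K Y (ARTriangle.delta.{w} K Y q)) := by
  have hfin := homFinite (T.tauInv K) Y
  have := ARTriangle.finite_stableHom.{w} (k := k) (T.tauInv K) Y
  have := T.finite_dual_ext K Y
  have : IsNoetherian k (Ext.{w} Y K 1) :=
    (isFiniteLength_iff_isNoetherian_isArtinian.1 hE.isFiniteLength_of_finite_dual).1
  -- Submodules over the endomorphism ring are in particular `k`-submodules, so the ascending chain
  -- condition passes up from `k`.
  have : IsNoetherian (End K) (Ext.{w} Y K 1) := isNoetherian_of_tower k inferInstance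
  have : IsNoetherian (End (T.tauInv K))ᵐᵒᵖ (ARTriangle.StableHom.{w} (T.tauInv K) Y) :=
    isNoetherian_of_tower k inferInstance
  have hle (L L' : Submodule (End K) (Ext.{w} Y K 1)) :
      T.gamma K Y L' ≤ T.gamma K Y L ↔ L ≤ L' := T.gamma_le_gamma_iff hE
  refine ⟨IsNoetherian.noetherian, IsNoetherian.noetherian, ⟨fun L L' h => ?_, fun H =>
    ⟨T.commonKernel H, T.gamma_commonKernel hE H⟩⟩, hle, T.eta_eq_gamma_delta hE K Y⟩
  exact le_antisymm ((hle L L').1 h.ge) ((hle L' L).1 h.le)
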